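/- Let $\varepsilon\in(0,\frac14)$ and let $m>1$ be a real constant with $$1-\frac1m\le \frac{e-1}{2\sqrt{\pi}\,e}\sqrt{\varepsilon}.$$ Let $F:\mathbb{R}\to\mathbb{R}$ be locally Lipschitz with $F(p)=\frac1m p^m$ for $p\in[0,1]$ and $F(p)\le p$ for $p\in[-1,0]$, and let $g(x)=\max\{1-|x|,0\}$ for $x\in\mathbb{R}$. Let $u^\varepsilon$ denote the viscosity solution of $$u^\varepsilon_t+F(u^\varepsilon_x)=\varepsilon u^\varepsilon_{xx}\ \text{ in }\mathbb{R}\times(0,\infty),\qquad u^\varepsilon(x,0)=g(x)\ \text{ on }\mathbb{R},$$ and let $u$ denote the viscosity solution of $$u_t+F(u_x)=0\ \text{ in }\mathbb{R}\times(0,\infty),\qquad u(x,0)=g(x)\ \text{ on }\mathbb{R};$$ here viscosity solutions are continuous on $\mathbb{R}\times[0,\infty)$ and bounded on $\mathbb{R}\times[0,T]$ for every $T>0$. Then $$|u^\varepsilon(0,1)-u(0,1)|\ge \frac{e-1}{2\sqrt{\pi}\,e}\sqrt{\varepsilon}.$$ -/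

import Mathlib

open Set Topology

/-- `φ` is of class `C²` on the open half-plane `ℝ × (0,∞)` (arguments: space, then time). -/
def IsTestFunction (φ : ℝ → ℝ → ℝ) : Prop :=
  ContDiffOn ℝ 2 (fun z : ℝ × ℝ => φ z.1 z.2) (univ ×ˢ Ioi 0)

/-- The residual `φ_t + F(φ_x) - ν φ_xx` at the point `(x, t)`. -/
noncomputable def hjResidual (F : ℝ → ℝ) (ν : ℝ) (φ : ℝ → ℝ → ℝ) (x t : ℝ) : ℝ :=
  deriv (fun s => φ x s) t + F (deriv (fun y => φ y t) x)
    - ν * iteratedDeriv 2 (fun y => φ y t) x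

/-- Viscosity subsolution of `u_t + F(u_x) = ν u_xx` in `ℝ × (0,∞)`. -/
def IsViscositySubsolution (F : ℝ → ℝ) (ν : ℝ) (u : ℝ → ℝ → ℝ) : Prop :=
  ∀ φ : ℝ → ℝ → ℝ, IsTestFunction φ → ∀ x t : ℝ, 0 < t →
    IsLocalMax (fun z : ℝ × ℝ => u z.1 z.2 - φ z.1 z.2) (x, t) → hjResidual F ν φ x t ≤ 0

/-- Viscosity supersolution of `u_t + F(u_x) = ν u_xx` in `ℝ × (0,∞)`. -/
def IsViscositySupersolution (F : ℝ → ℝ) (ν : ℝ) (u : ℝ → ℝ → ℝ) : Prop :=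
  ∀ φ : ℝ → ℝ → ℝ, IsTestFunction φ → ∀ x t : ℝ, 0 < t →
    IsLocalMin (fun z : ℝ × ℝ => u z.1 z.2 - φ z.1 z.2) (x, t) → 0 ≤ hjResidual F ν φ x t

/-- `u` is the viscosity solution of the Cauchy problem
`u_t + F(u_x) = ν u_xx` in `ℝ × (0,∞)`, `u(·,0) = g`, for a bounded initial datum `g`:
`u` is continuous on `ℝ × [0,∞)`, takes the initial values `g`, is both a viscosity subsolution
and a viscosity supersolution, and lies in the usual uniqueness class of functions that are
bounded on every strip `ℝ × [0,T]`. For `ν = 0` this is the first-order problem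
`u_t + F(u_x) = 0`. -/
structure IsViscositySolution (F : ℝ → ℝ) (ν : ℝ) (g : ℝ → ℝ) (u : ℝ → ℝ → ℝ) : Prop where
  continuousOn : ContinuousOn (fun z : ℝ × ℝ => u z.1 z.2) (univ ×ˢ Ici 0)
  initial : ∀ x : ℝ, u x 0 = g x
  bounded : ∀ T : ℝ, 0 < T → ∃ C : ℝ, ∀ x t : ℝ, 0 ≤ t → t ≤ T → |u x t| ≤ C
  subsolution : IsViscositySubsolution F ν u
  supersolution : IsViscositySupersolution F ν u

/-! Write `K` for the claimed bound. The inviscid value at `(0, 1)` is at most `1 - 1 / m ≤ K`,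
while viscosity forces a value of at least `2 * K`. Inviscid side: the tent lies below the ramp `(x
+ 1)⁺`, and `p - (1 - 1 / m) ≤ F p` on `[0, 1]`. The ramp moving right at unit speed and rising at
rate `1 - 1 / m` is therefore a supersolution once smoothed
(`IsViscositySubsolution.le_one_sub_inv`). Viscous side: `F p ≤ p` on `[-1, 1]`, so the solution of
`v_t + v_x = ε v_xx` started from the tent, whose slopes stay in `[-1, 1]`, is a subsolution. Its
value at `(0, 1)` is the Gaussian average of the tent about its corner `-1` with variance `2 * ε`
(`IsViscositySupersolution.gaussianTent_le`). The kink there contributes order `√ε`, and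
`one_sub_exp_mul_le_gaussianTent` bounds the average below by `2 * K`. Both barriers are smooth, so
comparison is only needed against classical functions, with no doubling of variables
(`IsViscositySubsolution.le_of_classical_supersolution`). -/

/-! ### Comparison with classical supersolutions -/

/-- The negative of a viscosity supersolution is a viscosity subsolution of the reflected
equation. -/
theorem IsViscositySupersolution.neg {F : ℝ → ℝ} {ν : ℝ} {u : ℝ → ℝ → ℝ}
    (hu : IsViscositySupersolution F ν u) :
    IsViscositySubsolution (fun p => -F (-p)) ν (fun x t => -u x t) := by
  intro φ hφ x t ht hmax
  have hmin : IsLocalMin (fun z : ℝ × ℝ => u z.1 z.2 - -φ z.1 z.2) (x, t) := by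
    filter_upwards [hmax] with z hz
    linarith
  have h := hu (fun x t => -φ x t) hφ.neg x t ht hmin
  have h2 : iteratedDeriv 2 (fun y => -φ y t) x = -iteratedDeriv 2 (fun y => φ y t) x := by
    simp only [iteratedDeriv_succ, iteratedDeriv_zero, deriv.fun_neg']
  simp only [hjResidual, deriv.fun_neg, h2] at h ⊢
  linarith

/-- This smooth substitute for `|x|` serves both as the spatial penalty and as the profile of the
smoothed ramp. -/
theorem hasDerivAt_sqrt_one_add_sq (x : ℝ) :
    HasDerivAt (fun y : ℝ => √(1 + y ^ 2)) (x / √(1 + x ^ 2)) x := by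
  have h : HasDerivAt (fun y : ℝ => 1 + y ^ 2) (2 * x) x := by
    simpa using (hasDerivAt_pow 2 x).const_add 1
  convert h.sqrt (by positivity) using 1
  field_simp

theorem abs_div_sqrt_one_add_sq_le_one (x : ℝ) : |x / √(1 + x ^ 2)| ≤ 1 := by
  rw [abs_div, abs_of_nonneg (Real.sqrt_nonneg _)]
  exact div_le_one_of_le₀ (Real.abs_le_sqrt (by linarith)) (Real.sqrt_nonneg _)

theorem hasDerivAt_div_sqrt_one_add_sq (x : ℝ) :
    HasDerivAt (fun y : ℝ => y / √(1 + y ^ 2)) (1 / ((1 + x ^ 2) * √(1 + x ^ 2))) x := by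
  have hs : √(1 + x ^ 2) ≠ 0 := by positivity
  refine ((hasDerivAt_id' x).div (hasDerivAt_sqrt_one_add_sq x) hs).congr_deriv ?_
  have h2 : √(1 + x ^ 2) ^ 2 = 1 + x ^ 2 := Real.sq_sqrt (by positivity)
  have h3 : (1 : ℝ) + x ^ 2 ≠ 0 := by positivity
  field_simp
  rw [h2]
  ring

/-- Comparison of a bounded viscosity subsolution with a classical supersolution having bounded
gradient. The maximum of the difference is localised by a penalisation in space and time. -/
theorem IsViscositySubsolution.le_of_classical_supersolution {F : ℝ → ℝ} {ν : ℝ} (hν : 0 ≤ ν)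
    (hF : LocallyLipschitz F) {u : ℝ → ℝ → ℝ} (hu : IsViscositySubsolution F ν u)
    (huc : ContinuousOn (fun z : ℝ × ℝ => u z.1 z.2) (univ ×ˢ Ici 0))
    {C : ℝ} (hC : ∀ x t : ℝ, 0 ≤ t → t ≤ 2 → u x t ≤ C)
    {φ φt φx φxx : ℝ → ℝ → ℝ} (hφ : IsTestFunction φ)
    (hφc : ContinuousOn (fun z : ℝ × ℝ => φ z.1 z.2) (univ ×ˢ Ici 0))
    (hφt : ∀ x t, 0 < t → HasDerivAt (fun s => φ x s) (φt x t) t)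
    (hφx : ∀ x t, 0 < t → HasDerivAt (fun y => φ y t) (φx x t) x)
    (hφxx : ∀ x t, 0 < t → HasDerivAt (fun y => φx y t) (φxx x t) x)
    {R : ℝ} (hR : ∀ x t, 0 < t → |φx x t| ≤ R)
    {B : ℝ} (hB : ∀ x t, 0 ≤ t → t ≤ 2 → B ≤ φ x t)
    (hinit : ∀ x, u x 0 ≤ φ x 0)
    (hres : ∀ x t, 0 < t → 0 ≤ φt x t + F (φx x t) - ν * φxx x t)
    (x t : ℝ) (ht0 : 0 ≤ t) (ht1 : t ≤ 1) : u x t ≤ φ x t := by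
  -- The margin `1` leaves room for the slope of the penalty, which is at most `δ < 1`.
  obtain ⟨L, hL⟩ := (hF.locallyLipschitzOn (s := Icc (-(R + 1)) (R + 1))).exists_lipschitzOnWith_of_compact
    isCompact_Icc
  -- The growth `δ * A` in time pays for the change of `F` (at most `L * δ`) and the penalty's
  -- diffusion (at most `ν * δ`); the spare `δ` makes the residual strictly positive.
  set A : ℝ := L + ν + 1 with hA
  have hA0 : 0 < A := by positivity
  have key : ∀ δ : ℝ, 0 < δ → δ < 1 →
      u x t ≤ φ x t + δ * (√(1 + x ^ 2) + A * t + 1) := by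
    intro δ hδ hδ1
    -- The penalty `δ * t ^ (n + 1)` costs at most `δ` up to time `1`, yet exceeds `C - B` at time
    -- `2`, so no positive maximum sits on the top edge.
    obtain ⟨n, hn⟩ : ∃ n : ℕ, (C - B) / δ < 2 ^ n := pow_unbounded_of_one_lt _ (by norm_num)
    have hn' : C - B < δ * 2 ^ (n + 1) := by
      rw [div_lt_iff₀ hδ] at hn
      have : (0 : ℝ) < 2 ^ n := by positivity
      rw [pow_succ]; nlinarith
    set Φ : ℝ → ℝ → ℝ := fun x t => φ x t + δ * (√(1 + x ^ 2) + A * t + t ^ (n + 1)) with hΦ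
    suffices h : u x t ≤ Φ x t by
      have h1 : t ^ (n + 1) ≤ 1 := pow_le_one₀ ht0 ht1
      have : δ * t ^ (n + 1) ≤ δ := by nlinarith
      simp only [hΦ] at h
      linarith
    have hsmooth : ContDiff ℝ 2 (fun z : ℝ × ℝ => √(1 + z.1 ^ 2) + A * z.2 + z.2 ^ (n + 1)) := by
      have h1 : ContDiff ℝ 2 (fun z : ℝ × ℝ => √(1 + z.1 ^ 2)) :=
        ContDiff.sqrt (by fun_prop) (fun z => by positivity)
      fun_prop
    by_contra! hlt
    set R' : ℝ := (C - B) / δ with hR'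
    have hout : ∀ y s : ℝ, 0 ≤ s → s ≤ 2 → R' < |y| → u y s - Φ y s < 0 := by
      intro y s hs0 hs2 hy
      have h1 := hC y s hs0 hs2
      have h2 := hB y s hs0 hs2
      have h3 : |y| ≤ √(1 + y ^ 2) := Real.abs_le_sqrt (by linarith)
      have h4 : C - B < δ * √(1 + y ^ 2) := by
        rw [hR', div_lt_iff₀ hδ] at hy
        nlinarith
      have h5 : 0 ≤ δ * (A * s + s ^ (n + 1)) := by positivity
      simp only [hΦ]
      linarith
    have hcont : ContinuousOn (fun z : ℝ × ℝ => u z.1 z.2 - Φ z.1 z.2) (univ ×ˢ Ici 0) :=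
      huc.sub (hφc.add (continuousOn_const.mul hsmooth.continuous.continuousOn))
    have hxR : |x| ≤ R' := by
      by_contra! h
      have := hout x t ht0 (by linarith) h
      linarith
    obtain ⟨⟨x₁, t₁⟩, hmem, hmax⟩ := (isCompact_Icc.prod isCompact_Icc :
      IsCompact (Icc (-R') R' ×ˢ Icc (0 : ℝ) 2)).exists_isMaxOn
      ⟨(x, t), ⟨abs_le.mp hxR, ht0, by linarith⟩⟩
      (hcont.mono (prod_mono (subset_univ _) (fun s hs => hs.1)))
    have hpos : 0 < u x₁ t₁ - Φ x₁ t₁ := by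
      have : u x t - Φ x t ≤ u x₁ t₁ - Φ x₁ t₁ :=
        hmax (show (x, t) ∈ Icc (-R') R' ×ˢ Icc (0 : ℝ) 2 from ⟨abs_le.mp hxR, ht0, by linarith⟩)
      linarith
    obtain ⟨-, ht₁0, ht₁2⟩ := hmem
    simp only at ht₁0 ht₁2
    have ht₁pos : 0 < t₁ := by
      rcases ht₁0.eq_or_lt with h | h
      · subst h
        have h1 := hinit x₁
        have h2 : 0 ≤ δ * √(1 + x₁ ^ 2) := by positivity
        simp [hΦ] at hpos
        linarith
      · exact h
    have ht₁lt : t₁ < 2 := by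
      rcases ht₁2.eq_or_lt with h | h
      · subst h
        have h1 := hC x₁ 2 (by norm_num) le_rfl
        have h2 := hB x₁ 2 (by norm_num) le_rfl
        have h3 : 0 ≤ δ * (√(1 + x₁ ^ 2) + A * 2) := by positivity
        simp only [hΦ] at hpos
        linarith
      · exact h
    have hloc : IsLocalMax (fun z : ℝ × ℝ => u z.1 z.2 - Φ z.1 z.2) (x₁, t₁) := by
      have hopen : (univ : Set ℝ) ×ˢ Ioo (0 : ℝ) 2 ∈ 𝓝 (x₁, t₁) :=
        (isOpen_univ.prod isOpen_Ioo).mem_nhds ⟨mem_univ _, ht₁pos, ht₁lt⟩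
      filter_upwards [hopen] with z hz
      by_cases h : |z.1| ≤ R'
      · exact hmax (show z ∈ Icc (-R') R' ×ˢ Icc (0 : ℝ) 2 from
          ⟨abs_le.mp h, hz.2.1.le, hz.2.2.le⟩)
      · have := hout z.1 z.2 hz.2.1.le hz.2.2.le (not_le.mp h)
        linarith
    have htest : IsTestFunction Φ :=
      ContDiffOn.add hφ (contDiff_const.mul hsmooth).contDiffOn
    have hle := hu Φ htest x₁ t₁ ht₁pos hloc
    have dt : deriv (fun s => Φ x₁ s) t₁ = φt x₁ t₁ + δ * (A + (n + 1) * t₁ ^ n) := by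
      have h1 : HasDerivAt (fun s : ℝ => √(1 + x₁ ^ 2) + A * s + s ^ (n + 1))
          (A + (n + 1) * t₁ ^ n) t₁ := by
        refine ((((hasDerivAt_id' t₁).const_mul A).const_add (√(1 + x₁ ^ 2))).add
          (hasDerivAt_pow (n + 1) t₁)).congr_deriv ?_
        simp
      exact ((hφt x₁ t₁ ht₁pos).add (h1.const_mul δ)).deriv
    have dx : ∀ y, deriv (fun y => Φ y t₁) y = φx y t₁ + δ * (y / √(1 + y ^ 2)) := by
      intro y
      exact ((hφx y t₁ ht₁pos).add ((((hasDerivAt_sqrt_one_add_sq y).add_const (A * t₁)).add_const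
        (t₁ ^ (n + 1))).const_mul δ)).deriv
    have dxx : iteratedDeriv 2 (fun y => Φ y t₁) x₁ =
        φxx x₁ t₁ + δ * (1 / ((1 + x₁ ^ 2) * √(1 + x₁ ^ 2))) := by
      rw [iteratedDeriv_succ, iteratedDeriv_one, funext dx]
      exact ((hφxx x₁ t₁ ht₁pos).add ((hasDerivAt_div_sqrt_one_add_sq x₁).const_mul δ)).deriv
    rw [hjResidual, dt, dx, dxx] at hle
    have hr := hres x₁ t₁ ht₁pos
    set q := x₁ / √(1 + x₁ ^ 2) with hq
    have hq1 : |q| ≤ 1 := abs_div_sqrt_one_add_sq_le_one x₁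
    have hδq : |δ * q| ≤ δ := by
      rw [abs_mul, abs_of_pos hδ]; nlinarith
    have hp := abs_le.mp (hR x₁ t₁ ht₁pos)
    have hδq' := abs_le.mp hδq
    have hlip := hL.dist_le_mul (φx x₁ t₁) ⟨by linarith [hp.1], by linarith [hp.2]⟩
      (φx x₁ t₁ + δ * q) ⟨by linarith [hp.1], by linarith [hp.2]⟩
    rw [Real.dist_eq, Real.dist_eq] at hlip
    have h1 : |φx x₁ t₁ - (φx x₁ t₁ + δ * q)| ≤ δ := by
      rw [sub_add_cancel_left, abs_neg]; exact hδq
    have h2 := (le_abs_self _).trans (hlip.trans (mul_le_mul_of_nonneg_left h1 L.2))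
    have h3 : 1 / ((1 + x₁ ^ 2) * √(1 + x₁ ^ 2)) ≤ 1 := by
      have a1 : 1 ≤ 1 + x₁ ^ 2 := by nlinarith
      have a2 : 1 ≤ √(1 + x₁ ^ 2) := Real.one_le_sqrt.mpr a1
      exact div_le_one_of_le₀ (one_le_mul_of_one_le_of_one_le a1 a2) (by positivity)
    have h4 : ν * (δ * (1 / ((1 + x₁ ^ 2) * √(1 + x₁ ^ 2)))) ≤ ν * δ :=
      mul_le_mul_of_nonneg_left (by nlinarith) hν
    have h5 : 0 ≤ δ * ((n + 1) * t₁ ^ n) := by positivity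
    change F (φx x₁ t₁) - F (φx x₁ t₁ + δ * q) ≤ (L : ℝ) * δ at h2
    have h6 : δ * A = L * δ + ν * δ + δ := by rw [hA]; ring
    linarith
  have hlim : Filter.Tendsto (fun δ : ℝ => φ x t + δ * (√(1 + x ^ 2) + A * t + 1)) (𝓝[>] 0)
      (𝓝 (φ x t)) := by
    have : Continuous (fun δ : ℝ => φ x t + δ * (√(1 + x ^ 2) + A * t + 1)) := by fun_prop
    simpa using (this.tendsto 0).mono_left nhdsWithin_le_nhds
  refine ge_of_tendsto hlim ?_
  filter_upwards [Ioo_mem_nhdsGT (zero_lt_one' ℝ)] with δ hδ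
  exact key δ hδ.1 hδ.2

theorem tent_eq_second_difference (x : ℝ) :
    max (1 - |x|) 0 = max (x + 1) 0 - 2 * max x 0 + max (x - 1) 0 := by
  rcases abs_cases x with ⟨h, h'⟩ | ⟨h, h'⟩ <;> rw [h] <;>
  rcases max_cases (x + 1) 0 with ⟨a, a'⟩ | ⟨a, a'⟩ <;>
  rcases max_cases x 0 with ⟨b, b'⟩ | ⟨b, b'⟩ <;>
  rcases max_cases (x - 1) 0 with ⟨c, c'⟩ | ⟨c, c'⟩ <;> rw [a, b, c] <;>
  first
    | (rw [max_eq_left (by linarith)]; linarith)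
    | (rw [max_eq_right (by linarith)]; linarith)

/-! ### Upper bound for the first-order solution -/

/-- Young's inequality for the power Hamiltonian, at velocity one. -/
theorem sub_one_add_inv_le_rpow_div {m p : ℝ} (hm : 1 < m) (hp : 0 ≤ p) :
    p - (1 - 1 / m) ≤ 1 / m * p ^ m := by
  -- Bernoulli's inequality: `p ^ m` lies above its tangent at `p = 1`.
  have h := one_add_mul_self_le_rpow_one_add (s := p - 1) (by linarith) hm.le
  rw [add_sub_cancel] at h
  have hm0 : 0 < m := by linarith
  have h2 := mul_le_mul_of_nonneg_left h (by positivity : 0 ≤ 1 / m)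
  have h3 : 1 / m * (1 + m * (p - 1)) = p - (1 - 1 / m) := by field_simp; ring
  linarith

/-- A first-order viscosity subsolution lying initially below the ramp `(1 + x)⁺` is bounded by
`1 - 1 / m` at `(0, 1)`. -/
theorem IsViscositySubsolution.le_one_sub_inv {F : ℝ → ℝ} {m : ℝ} (hm : 1 < m)
    (hF : LocallyLipschitz F) (hF_pos : ∀ p ∈ Icc (0 : ℝ) 1, F p = 1 / m * p ^ m)
    {u : ℝ → ℝ → ℝ} (hu : IsViscositySubsolution F 0 u)
    (huc : ContinuousOn (fun z : ℝ × ℝ => u z.1 z.2) (univ ×ˢ Ici 0))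
    {C : ℝ} (hC : ∀ x t : ℝ, 0 ≤ t → t ≤ 2 → u x t ≤ C)
    (hinit : ∀ x, u x 0 ≤ max (x + 1) 0) : u 0 1 ≤ 1 - 1 / m := by
  have hm1 : 0 ≤ 1 - 1 / m := by
    rw [sub_nonneg, div_le_one₀ (by linarith)]; exact hm.le
  refine le_of_forall_pos_le_add fun η hη => ?_
  -- At `(0, 1)` the argument `Z` vanishes and the smoothed ramp equals `δ / 2 = η`.
  set δ : ℝ := 2 * η with hδ
  have hδ0 : 0 < δ := by positivity
  set Z : ℝ → ℝ → ℝ := fun x t => (x - t + 1) / δ with hZ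
  have hZx : ∀ x t, HasDerivAt (fun y => Z y t) (1 / δ) x := fun x t =>
    (((hasDerivAt_id' x).sub_const t).add_const 1).div_const δ
  have hZt : ∀ x t, HasDerivAt (fun s => Z x s) (-1 / δ) t := fun x t =>
    (((hasDerivAt_id' t).const_sub x).add_const 1).div_const δ
  have hroot : ContDiff ℝ 2 (fun z : ℝ => √(1 + z ^ 2)) :=
    ContDiff.sqrt (by fun_prop) (fun z => by positivity)
  have hZc : ContDiff ℝ 2 (fun z : ℝ × ℝ => Z z.1 z.2) := by fun_prop
  have hsmooth : ContDiff ℝ 2 (fun z : ℝ × ℝ =>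
      δ / 2 * (Z z.1 z.2 + √(1 + Z z.1 z.2 ^ 2)) + (1 - 1 / m) * z.2) := by
    have := hroot.comp hZc
    exact (contDiff_const.mul (hZc.add this)).add (contDiff_const.mul contDiff_snd)
  have hq := fun x t => abs_le.mp (abs_div_sqrt_one_add_sq_le_one (Z x t))
  have hQ : ∀ x t, HasDerivAt (fun y => Z y t / √(1 + Z y t ^ 2))
      (1 / ((1 + Z x t ^ 2) * √(1 + Z x t ^ 2)) * (1 / δ)) x := fun x t =>
    HasDerivAt.comp (h₂ := fun z => z / √(1 + z ^ 2)) x (hasDerivAt_div_sqrt_one_add_sq (Z x t))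
      (hZx x t)
  have habs : ∀ z : ℝ, |z| ≤ √(1 + z ^ 2) := fun z => Real.abs_le_sqrt (by linarith)
  have hmain := hu.le_of_classical_supersolution le_rfl hF huc hC
    (φ := fun x t => δ / 2 * (Z x t + √(1 + Z x t ^ 2)) + (1 - 1 / m) * t)
    (φt := fun x t => -((1 + Z x t / √(1 + Z x t ^ 2)) / 2) + (1 - 1 / m))
    (φx := fun x t => (1 + Z x t / √(1 + Z x t ^ 2)) / 2)
    (φxx := fun x t => 1 / ((1 + Z x t ^ 2) * √(1 + Z x t ^ 2)) * (1 / δ) / 2)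
    hsmooth.contDiffOn hsmooth.continuous.continuousOn
    (fun x t _ => ((((hZt x t).add ((hasDerivAt_sqrt_one_add_sq (Z x t)).comp t (hZt x t))).const_mul
      (δ / 2)).add ((hasDerivAt_id' t).const_mul (1 - 1 / m))).congr_deriv (by field_simp; ring))
    (fun x t _ => ((((hZx x t).add ((hasDerivAt_sqrt_one_add_sq (Z x t)).comp x (hZx x t))).const_mul
      (δ / 2)).add_const _).congr_deriv (by field_simp))
    (fun x t _ => ((hQ x t).const_add 1).div_const 2)
    (R := 1)
    (fun x t _ => abs_le.mpr ⟨by linarith [(hq x t).1], by linarith [(hq x t).2]⟩)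
    (B := 0)
    (fun x t ht _ => by
      have h1 := neg_le_of_abs_le (habs (Z x t))
      have h2 : 0 ≤ δ / 2 * (Z x t + √(1 + Z x t ^ 2)) := mul_nonneg (by positivity) (by linarith)
      have h3 := mul_nonneg hm1 ht
      linarith)
    (fun x => by
      refine (hinit x).trans ?_
      have h1 := neg_le_of_abs_le (habs (Z x 0))
      have h2 := le_of_abs_le (habs (Z x 0))
      have h3 : δ * Z x 0 = x + 1 := by simp only [hZ]; field_simp; ring
      refine max_le ?_ ?_ <;> nlinarith)
    (fun x t _ => by
      have h0 : 0 ≤ (1 + Z x t / √(1 + Z x t ^ 2)) / 2 := by linarith [(hq x t).1]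
      rw [hF_pos _ ⟨h0, by linarith [(hq x t).2]⟩]
      have := sub_one_add_inv_le_rpow_div hm h0
      linarith)
    0 1 zero_le_one le_rfl
  have h0 : Z 0 1 = 0 := by simp [hZ]
  simp only [h0] at hmain
  norm_num [hδ] at hmain
  norm_num
  linarith

/-! ### Standard normal distribution and its averaged ramp -/

/-- The density of the standard normal distribution. -/
noncomputable def normalDensity (z : ℝ) : ℝ := (√(2 * Real.pi))⁻¹ * Real.exp (-(1 / 2) * z ^ 2)

/-- The distribution function of the standard normal distribution. -/
noncomputable def normalCdf (z : ℝ) : ℝ := 1 / 2 + ∫ y in (0 : ℝ)..z, normalDensity y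

/-- The expectation of `(z + Z)⁺` for a standard normal variable `Z`. -/
noncomputable def normalRamp (z : ℝ) : ℝ := normalDensity z + z * normalCdf z

theorem normalDensity_pos (z : ℝ) : 0 < normalDensity z := by
  unfold normalDensity; positivity

theorem normalDensity_neg (z : ℝ) : normalDensity (-z) = normalDensity z := by
  simp [normalDensity]

theorem normalDensity_le_zero (z : ℝ) : normalDensity z ≤ normalDensity 0 := by
  unfold normalDensity
  have : -(1 / 2) * z ^ 2 ≤ -(1 / 2) * 0 ^ 2 := by nlinarith [sq_nonneg z]
  gcongr

theorem contDiff_normalDensity : ContDiff ℝ 2 normalDensity := by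
  unfold normalDensity; fun_prop

theorem hasDerivAt_normalDensity (z : ℝ) :
    HasDerivAt normalDensity (-z * normalDensity z) z := by
  have h : HasDerivAt (fun y : ℝ => -(1 / 2) * y ^ 2) (-z) z :=
    ((hasDerivAt_pow 2 z).const_mul (-(1 / 2) : ℝ)).congr_deriv (by simp)
  exact (h.exp.const_mul (√(2 * Real.pi))⁻¹).congr_deriv (by unfold normalDensity; ring)

theorem hasDerivAt_normalCdf (z : ℝ) : HasDerivAt normalCdf (normalDensity z) z := by
  have hc := contDiff_normalDensity.continuous
  exact (intervalIntegral.integral_hasDerivAt_right (hc.intervalIntegrable _ _)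
    (hc.stronglyMeasurableAtFilter _ _) hc.continuousAt).const_add _

theorem hasDerivAt_normalRamp (z : ℝ) : HasDerivAt normalRamp (normalCdf z) z := by
  exact ((hasDerivAt_normalDensity z).add
    ((hasDerivAt_id' z).mul (hasDerivAt_normalCdf z))).congr_deriv (by ring)

theorem contDiff_normalRamp : ContDiff ℝ 2 normalRamp := by
  have h : ContDiff ℝ 2 normalCdf := by
    rw [show (2 : WithTop ℕ∞) = 1 + 1 by norm_num, contDiff_succ_iff_deriv]
    refine ⟨fun z => (hasDerivAt_normalCdf z).differentiableAt, by simp, ?_⟩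
    rw [show deriv normalCdf = normalDensity from funext fun z => (hasDerivAt_normalCdf z).deriv]
    exact contDiff_normalDensity.of_le (by norm_num)
  exact contDiff_normalDensity.add (contDiff_id.mul h)

theorem normalCdf_strictMono : StrictMono normalCdf :=
  strictMono_of_hasDerivAt_pos hasDerivAt_normalCdf normalDensity_pos

theorem normalCdf_neg (z : ℝ) : normalCdf (-z) = 1 - normalCdf z := by
  have h := intervalIntegral.integral_comp_neg (a := 0) (b := z) normalDensity
  simp only [normalDensity_neg, neg_zero] at h
  rw [normalCdf, normalCdf, h, intervalIntegral.integral_symm (-z) 0]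
  ring

theorem tendsto_normalCdf_atTop : Filter.Tendsto normalCdf Filter.atTop (𝓝 1) := by
  have hi : MeasureTheory.Integrable normalDensity :=
    (integrable_exp_neg_mul_sq (by norm_num : (0 : ℝ) < 1 / 2)).const_mul _
  have h := (MeasureTheory.intervalIntegral_tendsto_integral_Ioi 0 hi.integrableOn
    Filter.tendsto_id).const_add (1 / 2)
  have hv : ∫ y in Ioi (0 : ℝ), normalDensity y = 1 / 2 := by
    unfold normalDensity
    rw [MeasureTheory.integral_const_mul, integral_gaussian_Ioi,
      show Real.pi / (1 / 2) = 2 * Real.pi by ring]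
    field_simp
  rw [hv] at h
  norm_num at h
  exact h

theorem normalCdf_le_one (z : ℝ) : normalCdf z ≤ 1 :=
  normalCdf_strictMono.monotone.ge_of_tendsto tendsto_normalCdf_atTop z

theorem normalCdf_nonneg (z : ℝ) : 0 ≤ normalCdf z := by
  have := normalCdf_neg z
  linarith [normalCdf_le_one (-z)]

theorem tendsto_normalDensity_atTop : Filter.Tendsto normalDensity Filter.atTop (𝓝 0) := by
  have h1 : Filter.Tendsto (fun z : ℝ => -(1 / 2) * z ^ 2) Filter.atTop Filter.atBot :=
    (Filter.tendsto_pow_atTop (two_ne_zero)).const_mul_atTop_of_neg (by norm_num)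
  have h2 := (Real.tendsto_exp_atBot.comp h1).const_mul (√(2 * Real.pi))⁻¹
  rwa [mul_zero] at h2

theorem hasDerivAt_normalDensity_div {z : ℝ} (hz : z ≠ 0) :
    HasDerivAt (fun y => normalDensity y / y) (-normalDensity z - normalDensity z / z ^ 2) z := by
  exact ((hasDerivAt_normalDensity z).div (hasDerivAt_id' z) hz).congr_deriv (by field_simp)

theorem tendsto_normalDensity_div_atTop :
    Filter.Tendsto (fun z => normalDensity z / z) Filter.atTop (𝓝 0) :=
  tendsto_normalDensity_atTop.div_atTop Filter.tendsto_id

/-- Mills' upper bound for the Gaussian tail. -/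
theorem one_sub_normalCdf_le {z : ℝ} (hz : 0 < z) : 1 - normalCdf z ≤ normalDensity z / z := by
  have hd : ∀ y ∈ Ioi (0 : ℝ), HasDerivAt (fun y => normalDensity y / y - (1 - normalCdf y))
      (-(normalDensity y / y ^ 2)) y := by
    intro y hy
    exact ((hasDerivAt_normalDensity_div (ne_of_gt hy)).sub
      ((hasDerivAt_normalCdf y).const_sub 1)).congr_deriv (by ring)
  have hanti : AntitoneOn (fun y => normalDensity y / y - (1 - normalCdf y)) (Ioi 0) := by
    refine antitoneOn_of_hasDerivWithinAt_nonpos (convex_Ioi 0)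
      (fun y hy => (hd y hy).continuousAt.continuousWithinAt)
      (fun y hy => (hd y (interior_subset hy)).hasDerivWithinAt) (fun y hy => ?_)
    have := (normalDensity_pos y).le
    have : 0 ≤ normalDensity y / y ^ 2 := by positivity
    linarith
  have hlim : Filter.Tendsto (fun y => normalDensity y / y - (1 - normalCdf y)) Filter.atTop
      (𝓝 0) := by
    simpa using tendsto_normalDensity_div_atTop.sub (tendsto_normalCdf_atTop.const_sub 1)
  have := le_of_tendsto hlim (Filter.eventually_atTop.mpr ⟨z, fun y hy =>
    hanti (mem_Ioi.mpr hz) (mem_Ioi.mpr (hz.trans_le hy)) hy⟩)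
  linarith

/-- A lower bound of Mills type for the Gaussian tail. -/
theorem le_one_sub_normalCdf {z : ℝ} (hz : 1 ≤ z) :
    normalDensity z / z / 2 ≤ 1 - normalCdf z := by
  have hd : ∀ y ∈ Ici (1 : ℝ), HasDerivAt (fun y => 1 - normalCdf y - normalDensity y / y / 2)
      (-normalDensity y - (-normalDensity y - normalDensity y / y ^ 2) / 2) y := by
    intro y hy
    have hy : (1 : ℝ) ≤ y := hy
    exact ((hasDerivAt_normalCdf y).const_sub 1).sub
      ((hasDerivAt_normalDensity_div (by positivity)).div_const 2)
  have hanti : AntitoneOn (fun y => 1 - normalCdf y - normalDensity y / y / 2) (Ici 1) := by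
    refine antitoneOn_of_hasDerivWithinAt_nonpos (convex_Ici 1)
      (fun y hy => (hd y hy).continuousAt.continuousWithinAt)
      (fun y hy => (hd y (interior_subset hy)).hasDerivWithinAt) (fun y hy => ?_)
    have hy1 : (1 : ℝ) ≤ y := interior_subset hy
    have hp := (normalDensity_pos y).le
    -- This is where `1 ≤ y` enters: it makes the factor `1 / 2` sufficient.
    have : normalDensity y / y ^ 2 ≤ normalDensity y := div_le_self hp (one_le_pow₀ hy1)
    linarith
  have hlim : Filter.Tendsto (fun y => 1 - normalCdf y - normalDensity y / y / 2) Filter.atTop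
      (𝓝 0) := by
    simpa using (tendsto_normalCdf_atTop.const_sub 1).sub
      (tendsto_normalDensity_div_atTop.div_const 2)
  have := le_of_tendsto hlim (Filter.eventually_atTop.mpr ⟨z, fun y hy =>
    hanti (mem_Ici.mpr hz) (mem_Ici.mpr (hz.trans hy)) hy⟩)
  linarith

theorem normalRamp_sub_neg (z : ℝ) : normalRamp z - normalRamp (-z) = z := by
  simp only [normalRamp, normalDensity_neg, normalCdf_neg]; ring

/-- For negative `z` this is Mills' upper bound at `-z`, multiplied through by `-z`. -/
theorem normalRamp_nonneg (z : ℝ) : 0 ≤ normalRamp z := by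
  rcases le_or_gt 0 z with hz | hz
  · have := normalCdf_nonneg z
    have := (normalDensity_pos z).le
    unfold normalRamp; positivity
  · have h := one_sub_normalCdf_le (neg_pos.mpr hz)
    rw [normalCdf_neg, normalDensity_neg, le_div_iff₀ (neg_pos.mpr hz)] at h
    unfold normalRamp; linarith

theorem max_le_normalRamp (z : ℝ) : max z 0 ≤ normalRamp z :=
  max_le (by linarith [normalRamp_sub_neg z, normalRamp_nonneg (-z)]) (normalRamp_nonneg z)

theorem normalRamp_le (z : ℝ) : normalRamp z ≤ max z 0 + normalDensity 0 := by
  have h1 := normalDensity_le_zero z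
  have h2 : z * normalCdf z ≤ max z 0 := by
    rcases le_or_gt 0 z with hz | hz
    · exact (mul_le_of_le_one_right hz (normalCdf_le_one z)).trans (le_max_left _ _)
    · exact (mul_nonpos_of_nonpos_of_nonneg hz.le (normalCdf_nonneg z)).trans (le_max_right _ _)
  unfold normalRamp; linarith

theorem normalRamp_neg_le {z : ℝ} (hz : 1 ≤ z) : normalRamp (-z) ≤ normalDensity z / 2 := by
  have h := le_one_sub_normalCdf hz
  have hz0 : 0 < z := by linarith
  rw [div_right_comm, div_le_iff₀ hz0] at h
  rw [normalRamp, normalDensity_neg, normalCdf_neg]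
  linarith

/-! ### Gaussian averages of the ramp and the tent -/

/-- The expectation of `(y + σ Z)⁺` for a standard normal variable `Z`. -/
noncomputable def gaussianRamp (σ y : ℝ) : ℝ := σ * normalRamp (y / σ)

/-- The Gaussian average, with standard deviation `σ`, of the tent function `max (1 - |y|) 0`. -/
noncomputable def gaussianTent (σ y : ℝ) : ℝ :=
  gaussianRamp σ (y + 1) - 2 * gaussianRamp σ y + gaussianRamp σ (y - 1)

theorem max_le_gaussianRamp {σ : ℝ} (hσ : 0 < σ) (y : ℝ) : max y 0 ≤ gaussianRamp σ y := by
  have h := mul_le_mul_of_nonneg_left (max_le_normalRamp (y / σ)) hσ.le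
  rwa [mul_max_of_nonneg _ _ hσ.le, mul_div_cancel₀ _ hσ.ne', mul_zero] at h

theorem gaussianRamp_le {σ : ℝ} (hσ : 0 < σ) (y : ℝ) :
    gaussianRamp σ y ≤ max y 0 + σ * normalDensity 0 := by
  have h := mul_le_mul_of_nonneg_left (normalRamp_le (y / σ)) hσ.le
  rwa [mul_add, mul_max_of_nonneg _ _ hσ.le, mul_div_cancel₀ _ hσ.ne', mul_zero] at h

/-- Only the two outer ramps of the second difference can overshoot, each by at most `σ *
normalDensity 0`. -/
theorem gaussianTent_le {σ : ℝ} (hσ : 0 < σ) (y : ℝ) :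
    gaussianTent σ y ≤ max (1 - |y|) 0 + 2 * (σ * normalDensity 0) := by
  rw [tent_eq_second_difference, gaussianTent]
  linarith [gaussianRamp_le hσ (y + 1), gaussianRamp_le hσ (y - 1), max_le_gaussianRamp hσ y]

theorem contDiffOn_gaussianTent :
    ContDiffOn ℝ 2 (fun z : ℝ × ℝ => gaussianTent z.1 z.2) (Ioi 0 ×ˢ univ) := by
  have h : ∀ k : ℝ, ContDiffOn ℝ 2 (fun z : ℝ × ℝ => gaussianRamp z.1 (z.2 + k))
      (Ioi 0 ×ˢ univ) := fun k =>
    contDiff_fst.contDiffOn.mul (contDiff_normalRamp.comp_contDiffOn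
      ((contDiff_snd.add contDiff_const).contDiffOn.div contDiff_fst.contDiffOn
        fun z hz => (mem_Ioi.mp hz.1).ne'))
  simpa [gaussianTent, sub_eq_add_neg] using
    ((h 1).sub ((contDiffOn_const (c := (2 : ℝ))).mul (h 0))).add (h (-1))

/-- The ramp with its kink at `-1` contributes exactly `σ * normalDensity 0`. The one at the peak
costs at most `σ * normalDensity (1 / σ)`, and `2 ≤ (1 / σ) ^ 2` supplies the factor `exp (-1)`; the
third is nonnegative. -/
theorem one_sub_exp_mul_le_gaussianTent {σ : ℝ} (hσ : 0 < σ) (hσ1 : σ ^ 2 ≤ 1 / 2) :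
    (1 - Real.exp (-1)) * (σ * normalDensity 0) ≤ gaussianTent σ (-1) := by
  have hz : 1 ≤ 1 / σ := by rw [le_div_iff₀ hσ]; nlinarith
  have h1 := normalRamp_neg_le hz
  have h2 := normalRamp_nonneg ((-1 - 1) / σ)
  have h3 : normalDensity (1 / σ) ≤ normalDensity 0 * Real.exp (-1) := by
    have : 2 ≤ (1 / σ) ^ 2 := by
      rw [div_pow, one_pow, le_div_iff₀ (by positivity)]; linarith
    simp only [normalDensity]
    rw [mul_assoc, ← Real.exp_add]
    gcongr
    linarith
  have h4 : normalRamp ((-1 + 1) / σ) = normalDensity 0 := by simp [normalRamp]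
  have h5 : (-1 : ℝ) / σ = -(1 / σ) := by ring
  simp only [gaussianTent, gaussianRamp]
  rw [h4, h5]
  nlinarith

/-- The first space derivative of `gaussianTent`. -/
noncomputable def gaussianTentSlope (σ y : ℝ) : ℝ :=
  normalCdf ((y + 1) / σ) - 2 * normalCdf (y / σ) + normalCdf ((y - 1) / σ)

/-- The second space derivative of `gaussianTent`. -/
noncomputable def gaussianTentCurvature (σ y : ℝ) : ℝ :=
  (normalDensity ((y + 1) / σ) - 2 * normalDensity (y / σ) + normalDensity ((y - 1) / σ)) / σ

/-- The slope is a difference of two increments of `normalCdf`, each in `[0, 1]`. This keeps it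
where `F p ≤ p` is known. -/
theorem abs_gaussianTentSlope_le_one {σ : ℝ} (hσ : 0 < σ) (y : ℝ) :
    |gaussianTentSlope σ y| ≤ 1 := by
  have h1 : normalCdf (y / σ) ≤ normalCdf ((y + 1) / σ) :=
    normalCdf_strictMono.monotone (by gcongr; linarith)
  have h2 : normalCdf ((y - 1) / σ) ≤ normalCdf (y / σ) :=
    normalCdf_strictMono.monotone (by gcongr; linarith)
  have h3 := normalCdf_le_one ((y + 1) / σ)
  have h4 := normalCdf_nonneg ((y - 1) / σ)
  unfold gaussianTentSlope
  exact abs_le.mpr ⟨by linarith, by linarith⟩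

theorem hasDerivAt_gaussianTent_right {σ : ℝ} (hσ : 0 < σ) (y : ℝ) :
    HasDerivAt (gaussianTent σ) (gaussianTentSlope σ y) y := by
  have h : ∀ k : ℝ, HasDerivAt (fun y => gaussianRamp σ (y + k)) (normalCdf ((y + k) / σ)) y :=
    fun k => ((HasDerivAt.comp (h₂ := normalRamp) y (hasDerivAt_normalRamp ((y + k) / σ))
      (((hasDerivAt_id' y).add_const k).div_const σ)).const_mul σ).congr_deriv (by field_simp)
  have h2 := ((h 1).sub ((h 0).const_mul 2)).add (h (-1))
  simp only [add_zero, ← sub_eq_add_neg] at h2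
  exact h2

theorem hasDerivAt_gaussianTentSlope (σ y : ℝ) :
    HasDerivAt (gaussianTentSlope σ) (gaussianTentCurvature σ y) y := by
  have h : ∀ k : ℝ, HasDerivAt (fun y => normalCdf ((y + k) / σ))
      (normalDensity ((y + k) / σ) / σ) y :=
    fun k => (HasDerivAt.comp (h₂ := normalCdf) y (hasDerivAt_normalCdf ((y + k) / σ))
      (((hasDerivAt_id' y).add_const k).div_const σ)).congr_deriv (by ring)
  have h2 := ((h 1).sub ((h 0).const_mul 2)).add (h (-1))
  simp only [add_zero, ← sub_eq_add_neg] at h2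
  exact h2.congr_deriv (by unfold gaussianTentCurvature; ring)

/-- `gaussianTent`, transported with unit speed along a varying standard deviation. -/
theorem HasDerivAt.gaussianTent_transport {σ : ℝ → ℝ} {σ' t : ℝ} (x : ℝ) (h : HasDerivAt σ σ' t)
    (hσ : 0 < σ t) :
    HasDerivAt (fun s => gaussianTent (σ s) (x - s))
      (σ' * σ t * gaussianTentCurvature (σ t) (x - t) - gaussianTentSlope (σ t) (x - t)) t := by
  have hne := hσ.ne'
  have h1 : ∀ k : ℝ, HasDerivAt (fun s => gaussianRamp (σ s) (x - s + k))
      (σ' * normalDensity ((x - t + k) / σ t) - normalCdf ((x - t + k) / σ t)) t := by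
    intro k
    -- Varying `σ` in `σ * normalRamp (a / σ)` leaves only the density: the terms `z * normalCdf z`
    -- cancel.
    refine (h.mul ((hasDerivAt_normalRamp ((x - t + k) / σ t)).comp t
      ((((hasDerivAt_id' t).const_sub x).add_const k).div h hne))).congr_deriv ?_
    simp only [Function.comp, Pi.div_apply, normalRamp]
    field_simp
    ring
  have h2 := ((h1 1).sub ((h1 0).const_mul 2)).add (h1 (-1))
  simp only [add_zero, ← sub_eq_add_neg] at h2
  refine h2.congr_deriv ?_
  unfold gaussianTentCurvature gaussianTentSlope
  field_simp
  ring

/-! ### Lower bound for the viscous solution -/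

/-- A viscous supersolution dominates the Gaussian average of its initial tent, transported with
unit speed, because the Hamiltonian lies below the identity on `[-1, 1]`. -/
theorem IsViscositySupersolution.gaussianTent_le {F : ℝ → ℝ} {ε : ℝ} (hε : 0 < ε)
    (hF : LocallyLipschitz F) (hF_le : ∀ p ∈ Icc (-1 : ℝ) 1, F p ≤ p)
    {u : ℝ → ℝ → ℝ} (hu : IsViscositySupersolution F ε u)
    (huc : ContinuousOn (fun z : ℝ × ℝ => u z.1 z.2) (univ ×ˢ Ici 0))
    {C : ℝ} (hC : ∀ x t : ℝ, 0 ≤ t → t ≤ 2 → -u x t ≤ C)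
    (hinit : ∀ x, max (1 - |x|) 0 ≤ u x 0) : gaussianTent (√(2 * ε)) (-1) ≤ u 0 1 := by
  have hF' : LocallyLipschitz (fun p => -F (-p)) := by
    have hneg : LocallyLipschitz (fun p : ℝ => -p) :=
      (LipschitzWith.id (α := ℝ)).neg.locallyLipschitz
    exact hneg.comp (hF.comp hneg)
  -- Starting the heat flow `τ` earlier keeps `σ` positive at `t = 0`, where the averaged tent is
  -- smooth; subtracting `2 * (σ 0 * normalDensity 0)` puts it back below the initial tent.
  have key : ∀ τ : ℝ, 0 < τ →
      gaussianTent (√(2 * ε * (1 + τ))) (-1) - 2 * (√(2 * ε * τ) * normalDensity 0) ≤ u 0 1 := by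
    intro τ hτ
    -- Chosen so that `σ' * σ = ε`, the diffusion coefficient.
    set σ : ℝ → ℝ := fun t => √(2 * ε * (t + τ)) with hσ
    have hσpos : ∀ t, -τ < t → 0 < σ t := fun t ht =>
      Real.sqrt_pos.mpr (mul_pos (by positivity) (by linarith))
    have hσ' : ∀ t, 0 < t → HasDerivAt σ (ε / σ t) t := by
      intro t ht
      have h0 : 2 * ε * (t + τ) ≠ 0 := by positivity
      refine ((((hasDerivAt_id' t).add_const τ).const_mul (2 * ε)).sqrt h0).congr_deriv ?_
      rw [mul_one, mul_div_mul_left _ _ two_ne_zero]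
    have hmaps : ContDiffOn ℝ 2 (fun z : ℝ × ℝ => (σ z.2, z.1 - z.2)) (univ ×ˢ Ioi (-τ)) := by
      refine ContDiffOn.prodMk (ContDiffOn.sqrt (by fun_prop) fun z hz => ?_) (by fun_prop)
      exact (mul_pos (by positivity) (by linarith [mem_Ioi.mp hz.2])).ne'
    have hsmooth : ContDiffOn ℝ 2 (fun z : ℝ × ℝ =>
        2 * (σ 0 * normalDensity 0) - gaussianTent (σ z.2) (z.1 - z.2)) (univ ×ˢ Ioi (-τ)) :=
      contDiffOn_const.sub (contDiffOn_gaussianTent.comp hmaps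
        fun z hz => ⟨hσpos z.2 hz.2, mem_univ _⟩)
    have hmain := hu.neg.le_of_classical_supersolution hε.le hF' huc.neg hC
      (φ := fun x t => 2 * (σ 0 * normalDensity 0) - gaussianTent (σ t) (x - t))
      (φt := fun x t => -(ε / σ t * σ t * gaussianTentCurvature (σ t) (x - t)
        - gaussianTentSlope (σ t) (x - t)))
      (φx := fun x t => -gaussianTentSlope (σ t) (x - t))
      (φxx := fun x t => -gaussianTentCurvature (σ t) (x - t))
      (hsmooth.mono (prod_mono le_rfl (Ioi_subset_Ioi (by linarith))))
      (hsmooth.continuousOn.mono (prod_mono le_rfl fun t ht =>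
        mem_Ioi.mpr (by linarith [mem_Ici.mp ht])))
      (fun x t ht => ((hσ' t ht).gaussianTent_transport x (hσpos t (by linarith))).const_sub _)
      (fun x t ht => ((hasDerivAt_gaussianTent_right (hσpos t (by linarith)) _).comp_sub_const
        x t).const_sub _)
      (fun x t _ => ((hasDerivAt_gaussianTentSlope (σ t) (x - t)).comp_sub_const x t).neg)
      (R := 1)
      (fun x t ht => by
        rw [abs_neg]; exact abs_gaussianTentSlope_le_one (hσpos t (by linarith)) _)
      (B := -1 - 2 * (σ 2 * normalDensity 0))
      (fun x t ht ht2 => by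
        have h1 := _root_.gaussianTent_le (hσpos t (by linarith)) (x - t)
        have h2 : max (1 - |x - t|) 0 ≤ 1 :=
          max_le (by linarith [abs_nonneg (x - t)]) zero_le_one
        have h3 : σ t ≤ σ 2 := Real.sqrt_le_sqrt (by gcongr)
        have h4 := mul_le_mul_of_nonneg_right h3 (normalDensity_pos 0).le
        have h5 := mul_nonneg (Real.sqrt_nonneg (2 * ε * (0 + τ))) (normalDensity_pos 0).le
        change 0 ≤ σ 0 * normalDensity 0 at h5
        linarith)
      (fun x => by
        have h1 := _root_.gaussianTent_le (hσpos 0 (by linarith)) (x - 0)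
        rw [sub_zero] at h1 ⊢
        linarith [hinit x])
      -- The curvature terms cancel, and the residual of the reflected equation reduces to `p - F p`
      -- at the slope `p` of the averaged tent.
      (fun x t ht => by
        have hs := hσpos t (by linarith)
        have h := hF_le _ (abs_le.mp (abs_gaussianTentSlope_le_one hs (x - t)))
        rw [neg_neg, div_mul_cancel₀ _ hs.ne']
        linarith)
      0 1 zero_le_one le_rfl
    simp only [hσ, zero_add, zero_sub] at hmain
    linarith
  have hcont : Filter.Tendsto (fun τ : ℝ => gaussianTent (√(2 * ε * (1 + τ))) (-1)
      - 2 * (√(2 * ε * τ) * normalDensity 0)) (𝓝[>] 0) (𝓝 (gaussianTent (√(2 * ε)) (-1))) := by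
    have hc : ContinuousAt (fun τ : ℝ => gaussianTent (√(2 * ε * (1 + τ))) (-1)
        - 2 * (√(2 * ε * τ) * normalDensity 0)) 0 := by
      refine ContinuousAt.sub ?_ (by fun_prop)
      have hmem : (Ioi 0 ×ˢ univ : Set (ℝ × ℝ)) ∈ 𝓝 (√(2 * ε * (1 + 0)), (-1 : ℝ)) :=
        (isOpen_Ioi.prod isOpen_univ).mem_nhds ⟨Real.sqrt_pos.mpr (by linarith), mem_univ _⟩
      have h1 := contDiffOn_gaussianTent.continuousOn.continuousAt hmem
      exact ContinuousAt.comp (f := fun τ : ℝ => (√(2 * ε * (1 + τ)), (-1 : ℝ))) h1 (by fun_prop)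
    simpa using hc.tendsto.mono_left nhdsWithin_le_nhds
  refine le_of_tendsto hcont ?_
  filter_upwards [self_mem_nhdsWithin] with τ hτ
  exact key τ hτ

/-! ### Combination of the two bounds -/

theorem proposition4p2 (ε : ℝ) (hε : ε ∈ Set.Ioo (0 : ℝ) (1 / 4)) (m : ℝ) (hm : 1 < m)
    (hmε : 1 - 1 / m ≤ (Real.exp 1 - 1) / (2 * Real.sqrt Real.pi * Real.exp 1) * Real.sqrt ε)
    (F : ℝ → ℝ) (hF : LocallyLipschitz F)
    (hF_pos : ∀ p ∈ Set.Icc (0 : ℝ) 1, F p = 1 / m * p ^ m)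
    (hF_neg : ∀ p ∈ Set.Icc (-1 : ℝ) 0, F p ≤ p)
    (g : ℝ → ℝ) (hg : ∀ x : ℝ, g x = max (1 - |x|) 0)
    (uε u : ℝ → ℝ → ℝ)
    (huε : IsViscositySolution F ε g uε) (hu : IsViscositySolution F 0 g u) :
    (Real.exp 1 - 1) / (2 * Real.sqrt Real.pi * Real.exp 1) * Real.sqrt ε ≤ |uε 0 1 - u 0 1| := by
  obtain ⟨hε0, hε1⟩ := hε
  have hF_le : ∀ p ∈ Icc (-1 : ℝ) 1, F p ≤ p := by
    intro p hp
    rcases le_total p 0 with h | h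
    · exact hF_neg p ⟨hp.1, h⟩
    · rw [hF_pos p ⟨h, hp.2⟩]
      have h1 : p ^ m ≤ p := by simpa using Real.rpow_le_rpow_of_exponent_ge' h hp.2 zero_le_one hm.le
      have h2 : 1 / m ≤ 1 := by rw [div_le_one₀ (by linarith)]; exact hm.le
      exact (mul_le_of_le_one_left (Real.rpow_nonneg h m) h2).trans h1
  obtain ⟨C, hC⟩ := hu.bounded 2 two_pos
  obtain ⟨C', hC'⟩ := huε.bounded 2 two_pos
  have hupper : u 0 1 ≤ 1 - 1 / m := by
    refine hu.subsolution.le_one_sub_inv hm hF hF_pos hu.continuousOn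
      (fun x t h0 h2 => (abs_le.mp (hC x t h0 h2)).2) fun x => ?_
    rw [hu.initial, hg]
    exact max_le_max (by linarith [neg_abs_le x]) le_rfl
  have hlower : gaussianTent (√(2 * ε)) (-1) ≤ uε 0 1 :=
    huε.supersolution.gaussianTent_le hε0 hF hF_le huε.continuousOn
      (fun x t h0 h2 => neg_le.mpr (abs_le.mp (hC' x t h0 h2)).1)
      fun x => (hg x).symm.le.trans (huε.initial x).symm.le
  have htent := one_sub_exp_mul_le_gaussianTent (σ := √(2 * ε)) (by positivity)
    (by rw [Real.sq_sqrt (by positivity)]; linarith)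
  have hval : (1 - Real.exp (-1)) * (√(2 * ε) * normalDensity 0) =
      2 * ((Real.exp 1 - 1) / (2 * √Real.pi * Real.exp 1) * √ε) := by
    rw [normalDensity, Real.exp_neg, Real.sqrt_mul zero_le_two, Real.sqrt_mul zero_le_two]
    norm_num
    field_simp
  -- The viscous value is at least twice the bound, and `hmε` lets the inviscid value consume at
  -- most one copy.
  exact le_trans (by linarith) (le_abs_self _)
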